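/- Let $H$ be a real separable Hilbert space, $\mathcal H=L^2([0,\infty);H)$ and $\beta\in(0,1)$. For $u\in\mathcal H$ put $u=0$ on $(-\infty,0)$ and let $\hat u\in L^2(\mathbb R;H_{\mathbb C})$, with $H_{\mathbb C}$ the complexification of $H$, be its Fourier transform, i.e. the $L^2$-extension of $\hat u(r)=\int_{\mathbb R}e^{-irs}u(s)\,ds$. For $r\in\mathbb R$ let $(ir)^\beta=|r|^\beta\big(\cos\tfrac{\beta\pi}2+i\,\mathrm{sign}(r)\sin\tfrac{\beta\pi}2\big)$. Let $U_tu(r)=\mathbf 1_{[0,\infty)}(r-t)\,u(r-t)$, $r,t\ge 0$, be the right shift on $\mathcal H$. For $t\ge0$ let $\eta^\beta_t$ be the one-sided $\beta$-stable law, i.e. the probability measure on $[0,\infty)$ with $\int_0^\infty e^{-isx}\,\eta^\beta_t(dx)=e^{-t(is)^\beta}$ for all $s\in\mathbb R$, and let $$U^\beta_tu=\int_0^\infty U_su\;\eta^\beta_t(ds),\qquad u\in\mathcal H,\ t\ge 0 .$$ Let $\Lambda$ with domain $D(\Lambda,\mathcal H)$ be the generator of $(U^\beta_t)$ on $\mathcal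 H$: $\Lambda u=\lim_{t\downarrow0}\frac1t(U^\beta_tu-u)$ in $\mathcal H$, and $D(\Lambda,\mathcal H)$ is the set of all $u\in\mathcal H$ for which this limit exists. Then $$D(\Lambda,\mathcal H)=\{u\in\mathcal H:\ r\mapsto|r|^\beta\hat u(r)\in L^2(\mathbb R;H_{\mathbb C})\},$$ and for every $u\in D(\Lambda,\mathcal H)$ $$(\Lambda u)^\wedge(r)=-(ir)^\beta\,\hat u(r)\quad\text{for a.e. } r\in\mathbb R .$$ Moreover, if $\beta>\frac12$, then for every $u\in D(\Lambda,\mathcal H)$ there is a function $\tilde u:[0,\infty)\to H$ that is continuous, equals $u$ almost everywhere, and satisfies $\tilde u(0)=0$. -/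

import Mathlib

open MeasureTheory Filter Topology FourierTransform
open scoped ENNReal RealInnerProductSpace

set_option linter.unusedSectionVars false

/-- The complexification `H ⊕ iH` of a real Hilbert space `H`: the pair `(x, y)` stands for
`x + i y`, with norm `‖x + i y‖² = ‖x‖² + ‖y‖²`. -/
def HilbertComplexification (H : Type*) : Type _ := WithLp 2 (H × H)

namespace HilbertComplexification

variable {H : Type*} [NormedAddCommGroup H] [InnerProductSpace ℝ H]

noncomputable instance : NormedAddCommGroup (HilbertComplexification H) :=
  inferInstanceAs (NormedAddCommGroup (WithLp 2 (H × H)))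

instance [CompleteSpace H] : CompleteSpace (HilbertComplexification H) :=
  inferInstanceAs (CompleteSpace (WithLp 2 (H × H)))

/-- The element `x + i y`. -/
def mk (x y : H) : HilbertComplexification H := WithLp.toLp 2 (x, y)

/-- The real part of `x + i y`. -/
def re (z : HilbertComplexification H) : H := (WithLp.ofLp z).1

/-- The imaginary part of `x + i y`. -/
def im (z : HilbertComplexification H) : H := (WithLp.ofLp z).2

@[simp] theorem re_mk (x y : H) : (mk x y).re = x := rfl
@[simp] theorem im_mk (x y : H) : (mk x y).im = y := rfl
@[simp] theorem re_add (z w : HilbertComplexification H) : (z + w).re = z.re + w.re := rfl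
@[simp] theorem im_add (z w : HilbertComplexification H) : (z + w).im = z.im + w.im := rfl
@[simp] theorem re_zero : (0 : HilbertComplexification H).re = 0 := rfl
@[simp] theorem im_zero : (0 : HilbertComplexification H).im = 0 := rfl

theorem ext {z w : HilbertComplexification H} (h : z.re = w.re) (h' : z.im = w.im) : z = w :=
  (WithLp.ofLp_injective 2) (Prod.ext h h')

theorem norm_sq (z : HilbertComplexification H) : ‖z‖ ^ 2 = ‖z.re‖ ^ 2 + ‖z.im‖ ^ 2 :=
  WithLp.prod_norm_sq_eq_of_L2 (β := H) (α := H) z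

/-- `(a + i b) (x + i y) = (a x - b y) + i (a y + b x)`. -/
instance : SMul ℂ (HilbertComplexification H) :=
  ⟨fun c z => mk (c.re • z.re - c.im • z.im) (c.re • z.im + c.im • z.re)⟩

@[simp] theorem re_smul (c : ℂ) (z : HilbertComplexification H) :
    (c • z).re = c.re • z.re - c.im • z.im := rfl
@[simp] theorem im_smul (c : ℂ) (z : HilbertComplexification H) :
    (c • z).im = c.re • z.im + c.im • z.re := rfl

instance : Module ℂ (HilbertComplexification H) where
  one_smul z := ext (by simp) (by simp)
  mul_smul c d z := ext (by simp; module) (by simp; module)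
  smul_zero c := ext (by simp) (by simp)
  smul_add c z w := ext (by simp; module) (by simp; module)
  add_smul c d z := ext (by simp; module) (by simp; module)
  zero_smul z := ext (by simp) (by simp)

theorem norm_smul_eq (c : ℂ) (z : HilbertComplexification H) : ‖c • z‖ = ‖c‖ * ‖z‖ := by
  have h : ‖c • z‖ ^ 2 = (‖c‖ * ‖z‖) ^ 2 := by
    rw [mul_pow, norm_sq, norm_sq, re_smul, im_smul, Complex.sq_norm, Complex.normSq_apply,
      norm_sub_sq_real, norm_add_sq_real, norm_smul, norm_smul, norm_smul, norm_smul,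
      mul_pow, mul_pow, mul_pow, mul_pow, Real.norm_eq_abs, Real.norm_eq_abs, sq_abs, sq_abs,
      real_inner_smul_left, real_inner_smul_left, real_inner_smul_right, real_inner_smul_right,
      real_inner_comm z.re z.im]
    ring
  exact (sq_eq_sq₀ (norm_nonneg _) (by positivity)).1 h

/-- `⟨x + i y, x' + i y'⟩ = ⟨x, x'⟩ + ⟨y, y'⟩ + i (⟨x, y'⟩ - ⟨y, x'⟩)`, antilinear in the first
argument. -/
noncomputable instance : InnerProductSpace ℂ (HilbertComplexification H) where
  norm_smul_le c z := (norm_smul_eq c z).le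
  inner z w := ⟨⟪z.re, w.re⟫ + ⟪z.im, w.im⟫, ⟪z.re, w.im⟫ - ⟪z.im, w.re⟫⟩
  norm_sq_eq_re_inner z := by
    rw [norm_sq]
    simp
  conj_inner_symm z w := by
    apply Complex.ext
    · simp [real_inner_comm]
    · simp [real_inner_comm]
  add_left z w v := by
    apply Complex.ext
    · simp [inner_add_left]; ring
    · simp [inner_add_left]; ring
  smul_left z w c := by
    apply Complex.ext
    · simp [inner_add_left, inner_sub_left, real_inner_smul_left]; ring
    · simp [inner_add_left, inner_sub_left, real_inner_smul_left]; ring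

/-- The embedding `x ↦ x + i 0` of `H` into its complexification. -/
noncomputable def ofReal : H →ₗᵢ[ℝ] HilbertComplexification H where
  toFun x := mk x 0
  map_add' x y := ext (by simp) (by simp)
  map_smul' c x := ext
    (by change c • x = (((c : ℂ) • mk x 0 : HilbertComplexification H)).re
        rw [re_smul]; simp)
    (by change 0 = (((c : ℂ) • mk x 0 : HilbertComplexification H)).im
        rw [im_smul]; simp)
  norm_map' x := by
    have h : ‖mk x 0‖ ^ 2 = ‖x‖ ^ 2 := by rw [norm_sq]; simp
    exact (sq_eq_sq₀ (norm_nonneg _) (norm_nonneg _)).1 h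

end HilbertComplexification

/-- The space `L²([0, ∞); H)`. -/
abbrev HalfLineL2 (H : Type*) [NormedAddCommGroup H] : Type _ :=
  Lp H 2 ((volume : Measure ℝ).restrict (Set.Ici 0))

namespace HalfLineL2

variable {H : Type*} [NormedAddCommGroup H]

/-- The function `u`, set to `0` on `(-∞, 0)`. -/
noncomputable def zeroExt (u : HalfLineL2 H) : ℝ → H := (Set.Ici (0 : ℝ)).indicator u

theorem memLp_zeroExt (u : HalfLineL2 H) : MemLp (zeroExt u) 2 volume :=
  (memLp_indicator_iff_restrict measurableSet_Ici).2 (Lp.memLp u)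

theorem memLp_zeroExt_sub (t : ℝ) (u : HalfLineL2 H) :
    MemLp (fun r => zeroExt u (r - t)) 2 (volume.restrict (Set.Ici 0)) :=
  ((memLp_zeroExt u).comp_measurePreserving (measurePreserving_sub_right volume t)).restrict _

/-- The shift to the right: `(U_t u)(r) = 1_{[0, ∞)}(r - t) u(r - t)` for `r ∈ [0, ∞)`. -/
noncomputable def rightShift (t : ℝ) (u : HalfLineL2 H) : HalfLineL2 H :=
  (memLp_zeroExt_sub t u).toLp _

variable [InnerProductSpace ℝ H]

theorem memLp_ofReal_zeroExt (u : HalfLineL2 H) :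
    MemLp (fun r => HilbertComplexification.ofReal (zeroExt u r)) 2 volume :=
  HilbertComplexification.ofReal.toContinuousLinearMap.comp_memLp' (memLp_zeroExt u)

/-- `u`, extended by `0` to the real line, as an element of the complex Hilbert space
`L²(ℝ; H ⊕ iH)`. -/
noncomputable def toComplexL2 (u : HalfLineL2 H) :
    Lp (HilbertComplexification H) 2 (volume : Measure ℝ) :=
  (memLp_ofReal_zeroExt u).toLp _

/-- The Fourier transform `û(r) = ∫ e^{-i r s} u(s) ds` (extended to `L²`), where `u = 0` on `(-∞, 0)`.
Mathlib's unitary Fourier transform on `L²(ℝ)` is the extension of `ξ ↦ ∫ e^{-2 π i ξ s} u(s) ds`,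
so it is evaluated at `ξ = r / (2 π)`. -/
noncomputable def hat [CompleteSpace H] (u : HalfLineL2 H) : ℝ → HilbertComplexification H :=
  fun r => (𝓕 (toComplexL2 u) : Lp (HilbertComplexification H) 2 (volume : Measure ℝ))
    (r / (2 * Real.pi))

end HalfLineL2

/-! Existence of the one-sided stable laws, as weak limits of rescaled sums of independent
random variables with the Sibuya law, whose generating function is `1 - (1 - z)^β`. -/

namespace OneSidedStable

/-- The probabilities `(-1)^k (β choose (k + 1))`. -/
noncomputable def sibuya (β : ℝ) (k : ℕ) : ℝ := (-1) ^ k * Ring.choose β (k + 1)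

theorem choose_succ' (a : ℝ) (n : ℕ) :
    Ring.choose a (n + 1) * (n + 1) = Ring.choose a n * (a - n) := by
  rw [Ring.choose_eq_smul, Ring.choose_eq_smul, descPochhammer_succ_right, Polynomial.smeval_mul,
    Polynomial.smeval_sub, Polynomial.smeval_X, Polynomial.smeval_natCast, Nat.factorial_succ]
  have : (n.factorial : ℝ) ≠ 0 := by positivity
  push_cast
  simp only [smul_eq_mul, pow_one, pow_zero, nsmul_eq_mul, mul_one]
  field_simp

theorem sibuya_nonneg {β : ℝ} (h0 : 0 < β) (h1 : β < 1) (k : ℕ) : 0 ≤ sibuya β k := by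
  induction k with
  | zero => simp [sibuya, h0.le]
  | succ k ih =>
    have h := choose_succ' β (k + 1)
    have h2 : sibuya β (k + 1) * (k + 1 + 1) = sibuya β k * (k + 1 - β) := by
      unfold sibuya
      push_cast at h
      rw [mul_assoc, h, pow_succ]
      ring
    have h3 : 0 ≤ sibuya β k * (k + 1 - β) :=
      mul_nonneg ih (by have : (0 : ℝ) ≤ k := by positivity
                        linarith)
    rw [← h2] at h3
    exact nonneg_of_mul_nonneg_left h3 (by positivity)

theorem hasSum_sibuya_of_norm_lt {β : ℝ} {z : ℂ} (hz : ‖z‖ < 1) :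
    HasSum (fun k => (sibuya β k : ℂ) * z ^ (k + 1)) (1 - (1 - z) ^ (β : ℂ)) := by
  have h := (Complex.one_add_cpow_hasFPowerSeriesOnBall_zero (a := (β : ℂ))).hasSum (y := -z)
    (by simpa [enorm_eq_nnnorm, ← NNReal.coe_lt_coe] using hz)
  simp only [binomialSeries_apply, List.ofFn_const, List.prod_replicate, smul_eq_mul,
    ← sub_eq_add_neg] at h
  rw [← hasSum_nat_add_iff' 1] at h
  simp only [Finset.range_one, Finset.sum_singleton, Ring.choose_zero_right, pow_zero,
    mul_one] at h
  have h' := h.neg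
  rw [neg_sub, zero_sub, ← sub_eq_add_neg] at h'
  refine h'.congr_fun ?_
  intro k
  unfold sibuya
  push_cast [Complex.ofReal_choose]
  rw [neg_pow z, pow_succ (-1 : ℂ)]
  ring

theorem summable_sibuya {β : ℝ} (h0 : 0 < β) (h1 : β < 1) : Summable (sibuya β) := by
  refine summable_of_sum_range_le (c := 1) (sibuya_nonneg h0 h1) fun n => ?_
  have key : ∀ x ∈ Set.Ioo (0 : ℝ) 1, ∑ i ∈ Finset.range n, sibuya β i * x ^ (i + 1) ≤ 1 := by
    intro x hx
    have h := hasSum_sibuya_of_norm_lt (β := β) (z := (x : ℂ))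
      (by rw [Complex.norm_real, Real.norm_of_nonneg hx.1.le]; exact hx.2)
    have hr : HasSum (fun k => sibuya β k * x ^ (k + 1)) (1 - (1 - x) ^ β) := by
      rw [← Complex.hasSum_ofReal]
      push_cast [Complex.ofReal_cpow (sub_nonneg.2 hx.2.le)]
      exact h
    refine (sum_le_hasSum _ (fun i _ => mul_nonneg (sibuya_nonneg h0 h1 i)
      (pow_nonneg hx.1.le _)) hr).trans ?_
    have := Real.rpow_nonneg (sub_nonneg.2 hx.2.le) β
    linarith
  have hc : Tendsto (fun x : ℝ => ∑ i ∈ Finset.range n, sibuya β i * x ^ (i + 1)) (𝓝[<] 1)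
      (𝓝 (∑ i ∈ Finset.range n, sibuya β i * 1 ^ (i + 1))) :=
    (Continuous.tendsto (by fun_prop) 1).mono_left nhdsWithin_le_nhds
  simp only [one_pow, mul_one] at hc
  exact le_of_tendsto hc (Filter.eventually_of_mem (Ioo_mem_nhdsLT zero_lt_one) key)

theorem hasSum_sibuya {β : ℝ} (h0 : 0 < β) (h1 : β < 1) {z : ℂ} (hz : ‖z‖ ≤ 1) :
    HasSum (fun k => (sibuya β k : ℂ) * z ^ (k + 1)) (1 - (1 - z) ^ (β : ℂ)) := by
  have hb : ∀ (k : ℕ), ∀ w ∈ Metric.closedBall (0 : ℂ) 1,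
      ‖(sibuya β k : ℂ) * w ^ (k + 1)‖ ≤ sibuya β k := by
    intro k w hw
    rw [norm_mul, Complex.norm_real, Real.norm_of_nonneg (sibuya_nonneg h0 h1 k), norm_pow]
    exact mul_le_of_le_one_right (sibuya_nonneg h0 h1 k)
      (pow_le_one₀ (norm_nonneg _) (by simpa using hw))
  have hcont : ContinuousOn (fun w : ℂ => ∑' k, (sibuya β k : ℂ) * w ^ (k + 1))
      (Metric.closedBall 0 1) :=
    continuousOn_tsum (fun k => by fun_prop) (summable_sibuya h0 h1) hb
  have hzmem : z ∈ Metric.closedBall (0 : ℂ) 1 := by simpa using hz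
  have hsum : Summable (fun k => (sibuya β k : ℂ) * z ^ (k + 1)) :=
    Summable.of_norm_bounded (summable_sibuya h0 h1) (fun k => hb k z hzmem)
  have hpath : ∀ x ∈ Set.Ioo (0 : ℝ) 1, ‖(x : ℂ) * z‖ < 1 := by
    intro x hx
    rw [norm_mul, Complex.norm_real, Real.norm_of_nonneg hx.1.le]
    exact (mul_le_of_le_one_right hx.1.le hz).trans_lt hx.2
  have hlim0 : Tendsto (fun x : ℝ => (x : ℂ) * z) (𝓝[<] 1) (𝓝 z) := by
    have : Tendsto (fun x : ℝ => (x : ℂ) * z) (𝓝[<] 1) (𝓝 (((1 : ℝ) : ℂ) * z)) :=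
      (Continuous.tendsto (by fun_prop) 1).mono_left nhdsWithin_le_nhds
    simpa using this
  have hev : ∀ᶠ x : ℝ in 𝓝[<] 1, x ∈ Set.Ioo (0 : ℝ) 1 := Ioo_mem_nhdsLT zero_lt_one
  have hA := (hcont z hzmem).tendsto.comp (tendsto_nhdsWithin_iff.2
    ⟨hlim0, hev.mono fun x hx => by simpa using (hpath x hx).le⟩)
  have hB : Tendsto (fun x : ℝ => 1 - (1 - (x : ℂ) * z) ^ (β : ℂ)) (𝓝[<] 1)
      (𝓝 (1 - (1 - z) ^ (β : ℂ))) := by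
    refine Tendsto.const_sub _ ?_
    refine Tendsto.comp (Complex.continuousAt_cpow_const_of_re_pos (Or.inl ?_) (by simpa using h0))
      (hlim0.const_sub 1)
    have := (Complex.re_le_norm z).trans hz
    simpa using this
  have hEq := tendsto_nhds_unique (hA.congr' (hev.mono fun x hx =>
    (hasSum_sibuya_of_norm_lt (hpath x hx)).tsum_eq)) hB
  rw [← hEq]
  exact hsum.hasSum

/-- The Sibuya law: mass `sibuya β k` at `k + 1`. -/
noncomputable def sibuyaMeasure (β : ℝ) : Measure ℝ :=
  Measure.sum fun k : ℕ => ENNReal.ofReal (sibuya β k) • Measure.dirac ((k : ℝ) + 1)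

theorem isProbabilityMeasure_sibuyaMeasure {β : ℝ} (h0 : 0 < β) (h1 : β < 1) :
    IsProbabilityMeasure (sibuyaMeasure β) := by
  constructor
  have h := hasSum_sibuya h0 h1 (z := 1) (by simp)
  have h' : HasSum (sibuya β) 1 := by
    rw [← Complex.hasSum_ofReal]
    simpa [Complex.zero_cpow (Complex.ofReal_ne_zero.2 h0.ne')] using h
  simp only [sibuyaMeasure, Measure.sum_apply _ MeasurableSet.univ, Measure.smul_apply,
    measure_univ, smul_eq_mul, mul_one]
  rw [← ENNReal.ofReal_tsum_of_nonneg (sibuya_nonneg h0 h1) h'.summable, h'.tsum_eq]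
  simp

theorem sibuyaMeasure_Iio (β : ℝ) : sibuyaMeasure β (Set.Iio 0) = 0 := by
  simp only [sibuyaMeasure, Measure.sum_apply _ measurableSet_Iio, Measure.smul_apply,
    Measure.dirac_apply' _ measurableSet_Iio, ENNReal.tsum_eq_zero]
  intro k
  have : ¬ ((k : ℝ) + 1 < 0) := not_lt.2 (by positivity)
  simp [this]

theorem charFun_sibuyaMeasure {β : ℝ} (h0 : 0 < β) (h1 : β < 1) (s : ℝ) :
    charFun (sibuyaMeasure β) s = 1 - (1 - Complex.exp (s * Complex.I)) ^ (β : ℂ) := by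
  have := isProbabilityMeasure_sibuyaMeasure h0 h1
  have hint : Integrable (fun x : ℝ => Complex.exp (s * x * Complex.I)) (sibuyaMeasure β) := by
    refine Integrable.of_bound (Continuous.aestronglyMeasurable (by fun_prop)) 1
      (ae_of_all _ fun x => ?_)
    rw [← Complex.ofReal_mul, Complex.norm_exp_ofReal_mul_I]
  have h := hasSum_integral_measure hint
  rw [charFun_apply_real]
  refine h.unique ?_
  refine (hasSum_sibuya h0 h1 (z := Complex.exp (s * Complex.I))
    (by rw [Complex.norm_exp_ofReal_mul_I])).congr_fun fun k => ?_
  rw [integral_smul_measure, integral_dirac, ← Complex.exp_nat_mul,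
    ENNReal.toReal_ofReal (sibuya_nonneg h0 h1 k), Complex.real_smul]
  push_cast
  ring_nf

/-- Powers of a characteristic function of a probability measure on the half line. -/
theorem exists_conv_pow {ν : Measure ℝ} [IsProbabilityMeasure ν] (hν : ν (Set.Iio 0) = 0) (n : ℕ) :
    ∃ μ : Measure ℝ, IsProbabilityMeasure μ ∧ μ (Set.Iio 0) = 0 ∧
      ∀ s, charFun μ s = charFun ν s ^ n := by
  induction n with
  | zero => exact ⟨Measure.dirac 0, inferInstance, by simp, by simp⟩
  | succ n ih =>
    obtain ⟨μ, hμ, h0, hc⟩ := ih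
    refine ⟨μ ∗ ν, inferInstance, ?_, fun s => by rw [charFun_conv, hc, pow_succ]⟩
    have e1 : ∀ᵐ x ∂μ, 0 ≤ x := by
      rw [ae_iff]; simpa [Set.Iio] using h0
    have e2 : ∀ᵐ x ∂ν, 0 ≤ x := by
      rw [ae_iff]; simpa [Set.Iio] using hν
    rw [Measure.conv, Measure.map_apply (by fun_prop) measurableSet_Iio,
      Measure.measure_prod_null (measurableSet_Iio.preimage (by fun_prop))]
    filter_upwards [e1] with x hx
    refine measure_mono_null ?_ hν
    intro y hy
    simp only [Set.mem_preimage, Set.mem_Iio] at hy ⊢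
    linarith

theorem real_mul_cpow {a : ℝ} (ha : 0 < a) (z w : ℂ) :
    ((a : ℂ) * z) ^ w = (a : ℂ) ^ w * z ^ w := by
  by_cases hz : z = 0
  · subst hz
    by_cases hw : w = 0
    · simp [hw]
    · simp [Complex.zero_cpow hw]
  have ha' : (a : ℂ) ≠ 0 := Complex.ofReal_ne_zero.2 ha.ne'
  rw [Complex.cpow_def_of_ne_zero (mul_ne_zero ha' hz), Complex.cpow_def_of_ne_zero ha',
    Complex.cpow_def_of_ne_zero hz, Complex.log_ofReal_mul ha hz, add_mul, Complex.exp_add,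
    Complex.ofReal_log ha.le]

theorem tendsto_aux {β : ℝ} (h0 : 0 < β) {t : ℝ} (ht : 0 < t) (s : ℝ) :
    Tendsto (fun n : ℕ => (n : ℂ) *
      -(1 - Complex.exp (((t / n) ^ β⁻¹ * s : ℝ) * Complex.I)) ^ (β : ℂ)) atTop
      (𝓝 (-(t * (-(Complex.I * s)) ^ (β : ℂ)))) := by
  have hd : Tendsto (fun n : ℕ => (t / n) ^ β⁻¹) atTop (𝓝[≠] 0) := by
    refine tendsto_nhdsWithin_iff.2 ⟨?_, ?_⟩
    · have h := (tendsto_const_div_atTop_nhds_zero_nat t)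
      have := h.rpow_const (p := β⁻¹) (Or.inr (by positivity))
      rwa [Real.zero_rpow (by positivity)] at this
    · filter_upwards [eventually_gt_atTop 0] with n hn
      have : (0 : ℝ) < n := by exact_mod_cast hn
      exact (Real.rpow_pos_of_pos (by positivity) _).ne'
  have hderiv : HasDerivAt (fun x : ℝ => 1 - Complex.exp ((x * s : ℝ) * Complex.I))
      (-(Complex.I * s)) 0 := by
    have h1 : HasDerivAt (fun x : ℝ => ((x * s : ℝ) : ℂ) * Complex.I) (s * Complex.I) 0 := by
      have := ((hasDerivAt_id (0 : ℝ)).mul_const s).ofReal_comp.mul_const Complex.I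
      simpa using this
    have h2 := h1.cexp.const_sub 1
    simpa [mul_comm] using h2
  have hw := (hderiv.tendsto_slope_zero).comp hd
  have hlim := ((Complex.continuousAt_cpow_const_of_re_pos (z := -(Complex.I * s)) (w := β)
    (Or.inl (by simp)) (by simpa using h0)).tendsto.comp hw).const_mul (t : ℂ) |>.neg
  refine hlim.congr' ?_
  filter_upwards [eventually_gt_atTop 0] with n hn
  have hn' : (0 : ℝ) < n := by exact_mod_cast hn
  set δ : ℝ := (t / n) ^ β⁻¹ with hδ
  have hδ0 : 0 < δ := Real.rpow_pos_of_pos (by positivity) _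
  have hδβ : (δ : ℂ) ^ (β : ℂ) = t / n := by
    rw [← Complex.ofReal_cpow hδ0.le, hδ, ← Real.rpow_mul (by positivity),
      inv_mul_cancel₀ h0.ne', Real.rpow_one]
    push_cast
    rfl
  have hfac : (1 - Complex.exp ((δ * s : ℝ) * Complex.I)) =
      (δ : ℂ) * (δ⁻¹ • (1 - Complex.exp ((δ * s : ℝ) * Complex.I))) := by
    rw [Complex.real_smul, ← mul_assoc, ← Complex.ofReal_mul, mul_inv_cancel₀ hδ0.ne']
    simp
  rw [hfac, real_mul_cpow hδ0, hδβ]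
  have hnc : (n : ℂ) ≠ 0 := by exact_mod_cast hn.ne'
  simp only [Function.comp_apply, zero_add, zero_mul, Complex.ofReal_zero, Complex.exp_zero,
    sub_self, sub_zero, ← hδ]
  have hcancel : ∀ w : ℂ, (n : ℂ) * -((t : ℂ) / n * w) = -(t * w) := fun w => by
    field_simp
  rw [hcancel]

end OneSidedStable

/-- `μ` is the law at time `t` of the one-sided stable semigroup of order `β`: a probability
measure carried by `[0, ∞)` with Fourier transform `∫ e^{-i s x} μ(dx) = e^{-t (i s)^β}`, where
`(i s)^β = |s|^β e^{i (π β / 2) sign s}` is the principal power. -/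
structure IsOneSidedStable (β t : ℝ) (μ : Measure ℝ) : Prop where
  isProbabilityMeasure : IsProbabilityMeasure μ
  measure_Iio_zero : μ (Set.Iio 0) = 0
  fourier : ∀ s : ℝ, ∫ x in Set.Ici 0, Complex.exp (-(Complex.I * s * x)) ∂μ =
      Complex.exp (-(t * (Complex.I * s) ^ (β : ℂ)))

theorem exists_isOneSidedStable {β t : ℝ} (h0 : 0 < β) (h1 : β < 1) (ht : 0 ≤ t) :
    ∃ μ : Measure ℝ, IsOneSidedStable β t μ := by
  have hβ : (β : ℂ) ≠ 0 := Complex.ofReal_ne_zero.2 h0.ne'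
  rcases ht.eq_or_lt with rfl | ht
  · refine ⟨Measure.dirac 0, inferInstance, by simp, fun s => ?_⟩
    rw [Measure.restrict_eq_self_of_ae_mem (by simp [ae_dirac_eq])]
    simp
  have := OneSidedStable.isProbabilityMeasure_sibuyaMeasure h0 h1
  choose κ hκP hκ0 hκc using OneSidedStable.exists_conv_pow (OneSidedStable.sibuyaMeasure_Iio β)
  let ν : ℕ → Measure ℝ := fun n => (κ n).map (((t / n) ^ β⁻¹) * ·)
  have hνP : ∀ n, IsProbabilityMeasure (ν n) := fun n =>
    Measure.isProbabilityMeasure_map (by fun_prop)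
  have hν0 : ∀ n, ν n (Set.Iio 0) = 0 := by
    intro n
    rw [Measure.map_apply (by fun_prop) measurableSet_Iio]
    refine measure_mono_null ?_ (hκ0 n)
    intro x hx
    simp only [Set.mem_preimage, Set.mem_Iio] at hx ⊢
    by_contra hx'
    exact absurd hx (not_lt.2 (mul_nonneg (by positivity) (not_lt.1 hx')))
  have hlim : ∀ s : ℝ, Tendsto (fun n => charFun (ν n) s) atTop
      (𝓝 (Complex.exp (-(t * (-(Complex.I * s)) ^ (β : ℂ))))) := by
    intro s
    refine (Complex.tendsto_one_add_pow_exp_of_tendsto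
      (OneSidedStable.tendsto_aux h0 ht s)).congr fun n => ?_
    rw [charFun_map_mul, hκc, OneSidedStable.charFun_sibuyaMeasure h0 h1, ← sub_eq_add_neg]
  have hcont : ContinuousAt
      (fun s : ℝ => Complex.exp (-(t * (-(Complex.I * s)) ^ (β : ℂ)))) 0 := by
    refine ContinuousAt.cexp (ContinuousAt.neg (ContinuousAt.const_mul ?_ _))
    exact ContinuousAt.comp (g := fun z : ℂ => z ^ (β : ℂ)) (f := fun s : ℝ => -(Complex.I * s))
      (Complex.continuousAt_cpow_const_of_re_pos (Or.inl (by simp)) (by simpa using h0))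
      (by fun_prop)
  have htight := isTightMeasureSet_of_tendsto_charFun hcont hlim
  let P : ℕ → ProbabilityMeasure ℝ := fun n => ⟨ν n, hνP n⟩
  have hcpt : IsCompact (closure (Set.range P)) := by
    refine isCompact_closure_of_isTightMeasureSet ?_
    convert htight using 1
    ext x
    constructor
    · rintro ⟨_, ⟨n, rfl⟩, rfl⟩
      exact ⟨n, rfl⟩
    · rintro ⟨n, rfl⟩
      exact ⟨P n, ⟨n, rfl⟩, rfl⟩
  obtain ⟨μ, -, φ, hφ, hμ⟩ := hcpt.tendsto_subseq (x := P)
    (fun n => subset_closure (Set.mem_range_self n))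
  have hchar : ∀ s : ℝ, charFun (μ : Measure ℝ) s =
      Complex.exp (-(t * (-(Complex.I * s)) ^ (β : ℂ))) := fun s =>
    tendsto_nhds_unique (ProbabilityMeasure.tendsto_iff_tendsto_charFun.1 hμ s)
      ((hlim s).comp hφ.tendsto_atTop)
  have hμ0 : (μ : Measure ℝ) (Set.Iio 0) = 0 := by
    have h' : ∀ n, ((P ∘ φ) n : Measure ℝ) (Set.Iio 0) = 0 := fun n => hν0 (φ n)
    have h2 := ProbabilityMeasure.le_liminf_measure_open_of_tendsto hμ (G := Set.Iio 0) isOpen_Iio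
    refine le_antisymm (h2.trans ?_) bot_le
    simp only [h', liminf_const, le_refl]
  refine ⟨μ, inferInstance, hμ0, fun s => ?_⟩
  rw [Measure.restrict_eq_self_of_ae_mem]
  · have h := hchar (-s)
    rw [charFun_apply_real] at h
    push_cast at h
    rw [mul_neg, neg_neg] at h
    rw [← h]
    congr 1
    ext x
    congr 1
    ring
  · rw [ae_iff]
    simpa [Set.Iio] using hμ0

theorem IsOneSidedStable.unique {β t : ℝ} {μ ν : Measure ℝ} (hμ : IsOneSidedStable β t μ)
    (hν : IsOneSidedStable β t ν) : μ = ν := by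
  have key : ∀ {κ : Measure ℝ}, IsOneSidedStable β t κ → ∀ s : ℝ, charFun κ s =
      Complex.exp (-(t * (-(Complex.I * s)) ^ (β : ℂ))) := by
    intro κ hκ s
    have h := hκ.fourier (-s)
    rw [Measure.restrict_eq_self_of_ae_mem
      (by rw [ae_iff]; simpa [Set.Iio] using hκ.measure_Iio_zero)] at h
    rw [charFun_apply_real]
    push_cast at h
    rw [mul_neg] at h
    rw [← h]
    congr 1
    ext x
    congr 1
    ring
  have := hμ.isProbabilityMeasure
  have := hν.isProbabilityMeasure
  exact Measure.ext_of_charFun (funext fun s => (key hμ s).trans (key hν s).symm)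

open Classical in
/-- The law `η_t^β` of the one-sided stable semigroup of order `β ∈ (0, 1)` at time `t ≥ 0`, which
exists and is unique (`exists_isOneSidedStable`, `IsOneSidedStable.unique`). -/
noncomputable def oneSidedStable (β t : ℝ) : Measure ℝ :=
  if h : ∃ μ : Measure ℝ, IsOneSidedStable β t μ then h.choose else 0

theorem isOneSidedStable_oneSidedStable {β t : ℝ} (h0 : 0 < β) (h1 : β < 1) (ht : 0 ≤ t) :
    IsOneSidedStable β t (oneSidedStable β t) := by
  have h := exists_isOneSidedStable h0 h1 ht
  rw [oneSidedStable, dif_pos h]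
  exact h.choose_spec

/-- The subordinated semigroup `U_t^β u = ∫_0^∞ U_s u η_t^β(ds)`, a Bochner integral in
`L²([0, ∞); H)`. -/
noncomputable def HalfLineL2.stableShift {H : Type*} [NormedAddCommGroup H]
    [InnerProductSpace ℝ H] (β t : ℝ) (u : HalfLineL2 H) : HalfLineL2 H :=
  ∫ s in Set.Ici 0, HalfLineL2.rightShift s u ∂(oneSidedStable β t)

section Generator

variable {X : Type*} [NormedAddCommGroup X] [NormedSpace ℝ X]

/-- The domain of the generator of a semigroup `(T t)` on `X`: all `u` for which
`(T t u - u) / t` converges in norm as `t → 0+`. -/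
def generatorDomain (T : ℝ → X → X) : Set X :=
  {u | ∃ v : X, Tendsto (fun t : ℝ => t⁻¹ • (T t u - u)) (𝓝[>] 0) (𝓝 v)}

/-- The generator of `(T t)`: the (unique) limit of `(T t u - u) / t` as `t → 0+`. -/
noncomputable def generator (T : ℝ → X → X) (u : generatorDomain T) : X :=
  u.2.choose

theorem tendsto_generator (T : ℝ → X → X) (u : generatorDomain T) :
    Tendsto (fun t : ℝ => t⁻¹ • (T t u - (u : X))) (𝓝[>] 0) (𝓝 (generator T u)) :=
  u.2.choose_spec

end Generator

/-! By Plancherel, extending by zero, complexifying and taking the Fourier transform embeds `L²([0,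
∞); H)` isometrically into `L²(ℝ; H ⊕ iH)` (`fourierIsometry`). There the shift by `s ≥ 0` is
multiplication by `e^{-2πisξ}`, so averaging over the stable law gives multiplication by
`e^{-tψ(ξ)}` with `ψ(ξ) = (2πiξ)^β` (`fourierIsometry_stableShift`), and the difference quotient of
the semigroup is multiplication by `(e^{-tψ} - 1)/t`.

Since `0 < β < 1`, `Re ψ ≥ 0`; hence these multipliers are bounded by `|ψ|` for all `t > 0`, and
they tend to `-ψ` pointwise. If the quotients converge in `L²`, an a.e. convergent subsequence
identifies the transform of the limit as `-ψ 𝓕u`, which is therefore in `L²`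
(`fourierIsometry_ae_eq_of_tendsto`). Conversely, if `ψ 𝓕u ∈ L²`, dominated convergence gives
convergence on the Fourier side, and the limit comes from a function on the half line because the
range of an isometry on a complete space is closed (`exists_tendsto_of_memLp`). The semigroup law is
never needed.

For `β > 1/2` the weight `1/(1 + |2πξ|^β)` is square integrable, so Cauchy–Schwarz makes `𝓕u`
integrable. Fourier inversion then gives a representative continuous on all of `ℝ`; it vanishes on
`(-∞, 0)`, hence at `0`. -/

/-! ### The vector-valued Fourier transform on L²: translations and inversion -/

section FourierL2

open scoped ContDiff SchwartzMap

variable {F : Type*} [NormedAddCommGroup F] [InnerProductSpace ℂ F] [CompleteSpace F]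

/-- Two locally integrable functions that agree as tempered distributions are equal a.e. -/
theorem ae_eq_of_forall_integral_schwartzMap_smul_eq {f g : ℝ → F}
    (hf : LocallyIntegrable f) (hg : LocallyIntegrable g)
    (h : ∀ φ : 𝓢(ℝ, ℂ), HasCompactSupport φ → ∫ x, φ x • f x = ∫ x, φ x • g x) :
    f =ᵐ[volume] g := by
  refine ae_eq_of_integral_contDiff_smul_eq hf hg fun χ hχ hc => ?_
  have h1 : HasCompactSupport (Complex.ofRealCLM ∘ χ) := hc.comp_left rfl
  have h2 : ContDiff ℝ ∞ (Complex.ofRealCLM ∘ χ) := by fun_prop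
  simpa using h (h1.toSchwartzMap h2) (by exact h1)

/-- Pairing with Schwartz functions moves the transform onto the test function, because the `L²`
transform is compatible with that of tempered distributions. -/
theorem integral_smul_fourier_L2 (φ : 𝓢(ℝ, ℂ)) (f : Lp F 2 (volume : Measure ℝ)) :
    ∫ x, φ x • (𝓕 f : Lp F 2 (volume : Measure ℝ)) x = ∫ x, (𝓕 (φ : ℝ → ℂ)) x • f x := by
  have h := congrArg (fun T => T φ) (Lp.fourier_toTemperedDistribution_eq f)
  simpa [SchwartzMap.fourier_coe] using h.symm

theorem integral_smul_fourierInv_L2 (φ : 𝓢(ℝ, ℂ)) (f : Lp F 2 (volume : Measure ℝ)) :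
    ∫ x, φ x • (𝓕⁻ f : Lp F 2 (volume : Measure ℝ)) x = ∫ x, (𝓕⁻ (φ : ℝ → ℂ)) x • f x := by
  have h := congrArg (fun T => T φ) (Lp.fourierInv_toTemperedDistribution_eq f)
  simpa [SchwartzMap.fourierInv_coe] using h.symm

/-- The modulation factor `e^{-2 π i s ξ}`. -/
noncomputable def modulation (s ξ : ℝ) : ℂ := Complex.exp (-(Complex.I * (2 * Real.pi * ξ : ℝ) * s))

theorem norm_modulation (s ξ : ℝ) : ‖modulation s ξ‖ = 1 := by
  have : -(Complex.I * (2 * Real.pi * ξ : ℝ) * s) = ((-(2 * Real.pi * ξ * s) : ℝ) : ℂ) * Complex.I := by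
    push_cast; ring
  rw [modulation, this, Complex.norm_exp_ofReal_mul_I]

theorem continuous_modulation : Continuous (Function.uncurry modulation) := by
  unfold modulation Function.uncurry
  fun_prop

theorem contDiff_modulation (s : ℝ) : ContDiff ℝ ∞ (modulation s) := by
  unfold modulation
  have : ContDiff ℝ ∞ (fun ξ : ℝ => ((2 * Real.pi * ξ : ℝ) : ℂ)) :=
    Complex.ofRealCLM.contDiff.comp (contDiff_const.mul contDiff_id)
  fun_prop

theorem fourier_modulation_mul (s : ℝ) (φ : ℝ → ℂ) (x : ℝ) :
    𝓕 (fun ξ => modulation s ξ * φ ξ) x = 𝓕 φ (x + s) := by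
  rw [Real.fourier_real_eq_integral_exp_smul, Real.fourier_real_eq_integral_exp_smul]
  congr 1
  ext ξ
  rw [smul_eq_mul, smul_eq_mul, ← mul_assoc, modulation, ← Complex.exp_add]
  congr 2
  push_cast
  ring

/-- The `L²` Fourier transform turns translations into modulations. -/
theorem fourier_ae_eq_of_translate {f g : Lp F 2 (volume : Measure ℝ)} {s : ℝ}
    (h : g =ᵐ[volume] fun x => f (x - s)) :
    (𝓕 g : Lp F 2 (volume : Measure ℝ)) =ᵐ[volume]
      fun ξ => modulation s ξ • (𝓕 f : Lp F 2 (volume : Measure ℝ)) ξ := by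
  have hloc : LocallyIntegrable (𝓕 f : Lp F 2 (volume : Measure ℝ)) :=
    (Lp.memLp _).locallyIntegrable one_le_two
  refine ae_eq_of_forall_integral_schwartzMap_smul_eq
    ((Lp.memLp _).locallyIntegrable one_le_two)
    (hloc.continuous_smul (contDiff_modulation s).continuous) fun φ hφ => ?_
  -- Compact support of `φ` makes the modulated test function Schwartz with no estimate on the
  -- derivatives of the modulation.
  have h1 : HasCompactSupport (fun ξ => modulation s ξ * φ ξ) := hφ.mul_left
  have h2 : ContDiff ℝ ∞ (fun ξ => modulation s ξ * φ ξ) :=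
    (contDiff_modulation s).mul (φ.smooth _)
  have h3 := integral_smul_fourier_L2 (h1.toSchwartzMap h2) f
  simp only [HasCompactSupport.toSchwartzMap_toFun] at h3
  calc ∫ x, φ x • (𝓕 g : Lp F 2 (volume : Measure ℝ)) x
      = ∫ x, (𝓕 (φ : ℝ → ℂ)) x • g x := integral_smul_fourier_L2 φ g
    _ = ∫ x, (𝓕 (φ : ℝ → ℂ)) x • f (x - s) :=
        integral_congr_ae (h.mono fun x hx => by simp only [hx])
    _ = ∫ x, (𝓕 (φ : ℝ → ℂ)) (x + s) • f x := by
        rw [← integral_add_right_eq_self _ s]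
        simp
    _ = ∫ x, (𝓕 (fun ξ => modulation s ξ * φ ξ)) x • f x := by simp_rw [fourier_modulation_mul]
    _ = ∫ x, (modulation s x * φ x) • (𝓕 f : Lp F 2 (volume : Measure ℝ)) x := h3.symm
    _ = _ := by simp_rw [smul_smul, mul_comm]

theorem continuous_fourierInv_of_integrable {f : ℝ → F} (hf : Integrable f) :
    Continuous (𝓕⁻ f) :=
  VectorFourier.fourierIntegral_continuous Real.continuous_fourierChar
    (by exact continuous_inner.neg) hf

/-- On integrable functions, the inverse `L²` Fourier transform is the inverse Fourier integral. -/
theorem fourierInv_L2_ae_eq {f : Lp F 2 (volume : Measure ℝ)} (hf : Integrable f volume) :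
    (𝓕⁻ f : Lp F 2 (volume : Measure ℝ)) =ᵐ[volume] 𝓕⁻ (f : ℝ → F) := by
  refine ae_eq_of_forall_integral_schwartzMap_smul_eq
    ((Lp.memLp _).locallyIntegrable one_le_two) (continuous_fourierInv_of_integrable hf).locallyIntegrable
    fun φ hφ => ?_
  rw [integral_smul_fourierInv_L2]
  have := VectorFourier.integral_fourierIntegral_smul_eq_flip (L := -innerₗ ℝ)
    Real.continuous_fourierChar (by exact continuous_inner.neg) (φ.integrable (μ := volume)) hf
  -- The pairing `x ξ` is symmetric, so flipping it gives the same inverse transform.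
  have hflip : (-innerₗ ℝ).flip = -innerₗ ℝ := by
    ext; simp
  rw [hflip] at this
  exact this

end FourierL2

/-! ### Dominated convergence in L² -/

section DominatedConvergence

variable {α E : Type*} [MeasurableSpace α] {μ : Measure α} [NormedAddCommGroup E]

/-- Dominated convergence in `L²`. -/
theorem tendsto_toLp_two_of_dominated {ι : Type*} {l : Filter ι} [l.IsCountablyGenerated]
    {G : ι → α → E} {g : α → E} {b : α → ℝ} (hG : ∀ i, MemLp (G i) 2 μ) (hg : MemLp g 2 μ)
    (hb : MemLp b 2 μ) (hGb : ∀ᶠ i in l, ∀ᵐ x ∂μ, ‖G i x‖ ≤ b x) (hgb : ∀ᵐ x ∂μ, ‖g x‖ ≤ b x)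
    (hlim : ∀ᵐ x ∂μ, Tendsto (fun i => G i x) l (𝓝 (g x))) :
    Tendsto (fun i => (hG i).toLp (G i)) l (𝓝 (hg.toLp g)) := by
  rw [Lp.tendsto_Lp_iff_tendsto_eLpNorm'']
  have key : Tendsto (fun i => ∫⁻ x, ‖(G i - g) x‖ₑ ^ (2 : ℝ) ∂μ) l (𝓝 (∫⁻ _, 0 ∂μ)) := by
    -- Both `G i` and `g` are bounded by `b`, so their difference is bounded by `2b`.
    refine tendsto_lintegral_filter_of_dominated_convergence'
      (fun x => ‖(2 : ℝ) • b x‖ₑ ^ (2 : ℝ)) ?_ ?_ ?_ ?_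
    · exact .of_forall fun i => ((hG i).sub hg).1.enorm.pow_const _
    · filter_upwards [hGb] with i hi
      filter_upwards [hi, hgb] with x h1 h2
      gcongr
      rw [enorm_le_iff_norm_le]
      refine (norm_sub_le _ _).trans ?_
      rw [Real.norm_eq_abs]
      refine le_trans ?_ (le_abs_self _)
      simp only [smul_eq_mul]
      linarith
    · have := lintegral_rpow_enorm_lt_top_of_eLpNorm_lt_top (p := 2) (by simp) (by simp)
        (hb.const_smul (2 : ℝ)).2
      simpa using this.ne
    · filter_upwards [hlim] with x hx
      have h0 : Tendsto (fun i => G i x - g x) l (𝓝 0) := by simpa using hx.sub_const (g x)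
      have := (ENNReal.continuous_rpow_const (y := 2)).tendsto _ |>.comp h0.enorm
      simpa [Function.comp_def] using this
  have h2 := (ENNReal.continuous_rpow_const (y := 1 / 2)).tendsto _ |>.comp key
  simp only [lintegral_zero] at h2
  rw [ENNReal.zero_rpow_of_pos (by norm_num)] at h2
  refine h2.congr fun i => ?_
  rw [eLpNorm_eq_lintegral_rpow_enorm_toReal (by simp) (by simp)]
  simp

end DominatedConvergence

/-! ### The symbol and the exponential difference quotients -/

section Symbol

/-- The symbol `(i r)^β`. -/
noncomputable def stableSymbol (β r : ℝ) : ℂ := (Complex.I * (r : ℂ)) ^ (β : ℂ)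

theorem norm_stableSymbol {β : ℝ} (h0 : 0 < β) (r : ℝ) : ‖stableSymbol β r‖ = |r| ^ β := by
  rw [stableSymbol, Complex.norm_cpow_of_imp]
  · simp
  · intro _ h
    exact absurd (by simpa using h) h0.ne'

theorem stableSymbol_re_nonneg {β : ℝ} (h0 : 0 < β) (h1 : β < 1) (r : ℝ) :
    0 ≤ (stableSymbol β r).re := by
  rw [stableSymbol, Complex.cpow_ofReal_re]
  -- `i r` is purely imaginary, so its argument is at most `π/2` in absolute value, and multiplying
  -- by `β < 1` keeps it there.
  have harg : |Complex.arg (Complex.I * r)| ≤ Real.pi / 2 :=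
    Complex.abs_arg_le_pi_div_two_iff.2 (by simp)
  have h : |Complex.arg (Complex.I * r) * β| ≤ Real.pi / 2 := by
    rw [abs_mul, abs_of_pos h0]
    nlinarith [abs_nonneg (Complex.arg (Complex.I * r))]
  exact mul_nonneg (by positivity) (Real.cos_nonneg_of_mem_Icc (abs_le.1 h))

theorem measurable_stableSymbol (β : ℝ) : Measurable (stableSymbol β) := by
  unfold stableSymbol
  fun_prop

/-- Mean value inequality on the convex left half-plane, where the derivative of `exp` has modulus
at most 1. -/
theorem norm_exp_sub_one_le_of_re_nonpos {z : ℂ} (hz : z.re ≤ 0) : ‖Complex.exp z - 1‖ ≤ ‖z‖ := by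
  have h := (convex_halfSpace_re_le 0).norm_image_sub_le_of_norm_hasDerivWithin_le
    (f := Complex.exp) (f' := Complex.exp) (C := 1) (x := 0) (y := z)
    (fun x _ => (Complex.hasDerivAt_exp x).hasDerivWithinAt)
    (fun x hx => by
      rw [Complex.norm_exp]
      exact Real.exp_le_one_iff.2 hx) (by simp) hz
  simpa using h

/-- The bound does not depend on `t`; it supplies the dominating function. At `t = 0` the left side
is `0` by the convention `0⁻¹ = 0`. -/
theorem norm_diffQuot_exp_le {z : ℂ} (hz : 0 ≤ z.re) {t : ℝ} (ht : 0 ≤ t) :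
    ‖(t : ℂ)⁻¹ * (Complex.exp (-(t * z)) - 1)‖ ≤ ‖z‖ := by
  rcases ht.eq_or_lt with rfl | ht
  · simp
  have h := norm_exp_sub_one_le_of_re_nonpos (z := -(t * z))
    (by simpa using mul_nonneg ht.le hz)
  rw [norm_neg, norm_mul, Complex.norm_real, Real.norm_of_nonneg ht.le] at h
  rw [norm_mul, norm_inv, Complex.norm_real, Real.norm_of_nonneg ht.le,
    inv_mul_le_iff₀ ht]
  exact h

theorem tendsto_diffQuot_exp (z : ℂ) :
    Tendsto (fun t : ℝ => (t : ℂ)⁻¹ * (Complex.exp (-(t * z)) - 1)) (𝓝[>] 0) (𝓝 (-z)) := by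
  have h1 : HasDerivAt (fun t : ℝ => Complex.exp (-(t * z))) (-z) 0 := by
    have := (((hasDerivAt_id (0 : ℝ)).ofReal_comp.mul_const z).neg).cexp
    simpa using this
  have := h1.tendsto_slope_zero.mono_left (nhdsGT_le_nhdsNE (0 : ℝ))
  simpa using this

end Symbol

/-! ### The half-line shifts on the Fourier side -/

namespace HalfLineL2

variable {H : Type*} [NormedAddCommGroup H]

theorem zeroExt_congr {u : HalfLineL2 H} {f : ℝ → H}
    (h : u =ᵐ[volume.restrict (Set.Ici 0)] f) :
    zeroExt u =ᵐ[volume] (Set.Ici (0 : ℝ)).indicator f := by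
  filter_upwards [(ae_restrict_iff' measurableSet_Ici).1 h] with x hx
  by_cases hm : x ∈ Set.Ici (0 : ℝ)
  · simp [zeroExt, hm, hx hm]
  · simp [zeroExt, hm]

theorem zeroExt_add (u v : HalfLineL2 H) :
    zeroExt (u + v) =ᵐ[volume] fun x => zeroExt u x + zeroExt v x := by
  refine (zeroExt_congr (Lp.coeFn_add u v)).trans (.of_forall fun x => ?_)
  rw [Set.indicator_add']
  rfl

/-- For `s ≥ 0` the translate of the extension already vanishes on `(-∞, 0)`, so cutting off at `0`
loses nothing. -/
theorem zeroExt_rightShift {s : ℝ} (hs : 0 ≤ s) (u : HalfLineL2 H) :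
    zeroExt (rightShift s u) =ᵐ[volume] fun x => zeroExt u (x - s) := by
  refine (zeroExt_congr (MemLp.coeFn_toLp (memLp_zeroExt_sub s u))).trans (.of_forall fun x => ?_)
  by_cases hm : x ∈ Set.Ici (0 : ℝ)
  · simp [hm]
  · have : x - s ∉ Set.Ici (0 : ℝ) := by
      simp only [Set.mem_Ici, not_le] at hm ⊢
      linarith
    simp [hm, zeroExt, Set.indicator_of_notMem this]

variable [InnerProductSpace ℝ H]

theorem zeroExt_smul (c : ℝ) (u : HalfLineL2 H) :
    zeroExt (c • u) =ᵐ[volume] fun x => c • zeroExt u x := by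
  refine (zeroExt_congr (Lp.coeFn_smul c u)).trans (.of_forall fun x => ?_)
  simp [zeroExt, Set.indicator_apply]

theorem coeFn_toComplexL2 (u : HalfLineL2 H) :
    toComplexL2 u =ᵐ[volume] fun x => HilbertComplexification.ofReal (zeroExt u x) :=
  MemLp.coeFn_toLp _

/-- `toComplexL2` as a real-linear isometry. -/
noncomputable def toComplexL2LinearIsometry :
    HalfLineL2 H →ₗᵢ[ℝ] Lp (HilbertComplexification H) 2 (volume : Measure ℝ) where
  toFun := toComplexL2
  map_add' u v := by
    refine Lp.ext ?_
    filter_upwards [coeFn_toComplexL2 (u + v), coeFn_toComplexL2 u, coeFn_toComplexL2 v,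
      Lp.coeFn_add (toComplexL2 u) (toComplexL2 v), zeroExt_add u v] with x h1 h2 h3 h4 h5
    rw [h1, h4, Pi.add_apply, h2, h3, h5, map_add]
  map_smul' c u := by
    refine Lp.ext ?_
    filter_upwards [coeFn_toComplexL2 (c • u), coeFn_toComplexL2 u,
      Lp.coeFn_smul c (toComplexL2 u), zeroExt_smul c u] with x h1 h2 h3 h4
    rw [h1, RingHom.id_apply, h3, Pi.smul_apply, h2, h4, map_smul]
  norm_map' u := by
    change ‖toComplexL2 u‖ = ‖u‖
    rw [toComplexL2, Lp.norm_toLp, Lp.norm_def,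
      ← eLpNorm_indicator_eq_eLpNorm_restrict measurableSet_Ici]
    congr 1
    exact eLpNorm_congr_norm_ae (.of_forall fun x => LinearIsometry.norm_map _ _)

variable [CompleteSpace H]

/-- The isometry `u ↦ 𝓕 u` of `L²([0, ∞); H)` into `L²(ℝ; H ⊕ iH)`, with Mathlib's normalisation
of the Fourier transform. -/
noncomputable def fourierIsometry :
    HalfLineL2 H →ₗᵢ[ℝ] Lp (HilbertComplexification H) 2 (volume : Measure ℝ) where
  toFun u := 𝓕 (toComplexL2 u)
  map_add' u v := by
    rw [← FourierTransform.fourier_add]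
    exact congrArg _ (toComplexL2LinearIsometry.map_add u v)
  map_smul' c u := by
    have h := toComplexL2LinearIsometry.map_smul c u
    -- Homogeneity of the transform is applied with complex scalars, so the real action has to be
    -- rewritten as the complex one.
    have h2 : (c • toComplexL2 u) = ((c : ℂ) • toComplexL2 u) := by
      refine Lp.ext ?_
      filter_upwards [Lp.coeFn_smul c (toComplexL2 u), Lp.coeFn_smul (c : ℂ) (toComplexL2 u)]
        with x h1 h2
      rw [h1, h2, Pi.smul_apply, Pi.smul_apply, Complex.coe_smul]
    have h3 : (c • (𝓕 (toComplexL2 u) : Lp (HilbertComplexification H) 2 (volume : Measure ℝ)))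
        = ((c : ℂ) • (𝓕 (toComplexL2 u) : Lp (HilbertComplexification H) 2 (volume : Measure ℝ))) := by
      refine Lp.ext ?_
      filter_upwards [Lp.coeFn_smul c (𝓕 (toComplexL2 u)), Lp.coeFn_smul (c : ℂ) (𝓕 (toComplexL2 u))]
        with x h1 h2
      rw [h1, h2, Pi.smul_apply, Pi.smul_apply, Complex.coe_smul]
    rw [RingHom.id_apply, h3, ← FourierTransform.fourier_smul, ← h2]
    exact congrArg _ h
  norm_map' u := (Lp.norm_fourier_eq _).trans (toComplexL2LinearIsometry.norm_map u)

theorem hat_eq (u : HalfLineL2 H) (r : ℝ) : hat u r = fourierIsometry u (r / (2 * Real.pi)) := rfl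

theorem fourierIsometry_rightShift {s : ℝ} (hs : 0 ≤ s) (u : HalfLineL2 H) :
    fourierIsometry (rightShift s u) =ᵐ[volume] fun ξ => modulation s ξ • fourierIsometry u ξ := by
  refine fourier_ae_eq_of_translate (f := toComplexL2 u) ?_
  have h := (measurePreserving_sub_right volume s).quasiMeasurePreserving.ae_eq_comp
    (coeFn_toComplexL2 u)
  filter_upwards [coeFn_toComplexL2 (rightShift s u), zeroExt_rightShift hs u, h] with x h1 h2 h3
  rw [h1, h2]
  exact h3.symm

theorem memLp_modulation_smul (s : ℝ) (g : Lp (HilbertComplexification H) 2 (volume : Measure ℝ)) :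
    MemLp (fun ξ => modulation s ξ • g ξ) 2 volume := by
  refine (Lp.memLp g).of_le ?_ (.of_forall fun ξ => ?_)
  · exact (contDiff_modulation s).continuous.aestronglyMeasurable.smul (Lp.memLp g).1
  · rw [norm_smul, norm_modulation, one_mul]

/-- Strong continuity of the shift semigroup. -/
theorem continuousOn_rightShift (u : HalfLineL2 H) :
    ContinuousOn (fun s => rightShift s u) (Set.Ici 0) := by
  -- Modulation is continuous in every real `s`; it represents the shift only for `s ≥ 0`.
  have hmod : Continuous fun s =>
      (memLp_modulation_smul s (fourierIsometry u)).toLp (fun ξ => modulation s ξ • fourierIsometry u ξ) := by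
    refine continuous_iff_continuousAt.2 fun s => ?_
    refine tendsto_toLp_two_of_dominated (b := fun ξ => ‖fourierIsometry u ξ‖) _
      (memLp_modulation_smul s _) (Lp.memLp (fourierIsometry u)).norm ?_ ?_ ?_
    · exact .of_forall fun s => .of_forall fun ξ => by rw [norm_smul, norm_modulation, one_mul]
    · exact .of_forall fun ξ => by rw [norm_smul, norm_modulation, one_mul]
    · refine .of_forall fun ξ => Tendsto.smul_const ?_ _
      exact (continuous_modulation.comp (Continuous.prodMk_left ξ)).tendsto s
  rw [fourierIsometry.isometry.isUniformInducing.isInducing.continuousOn_iff]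
  refine hmod.continuousOn.congr fun s hs => ?_
  exact Lp.ext ((fourierIsometry_rightShift hs u).trans (MemLp.coeFn_toLp _).symm)

theorem norm_rightShift {s : ℝ} (hs : 0 ≤ s) (u : HalfLineL2 H) : ‖rightShift s u‖ = ‖u‖ := by
  rw [← fourierIsometry.norm_map, ← fourierIsometry.norm_map u, Lp.norm_def, Lp.norm_def,
    eLpNorm_congr_ae (fourierIsometry_rightShift hs u)]
  congr 1
  exact eLpNorm_congr_norm_ae (.of_forall fun ξ => by rw [norm_smul, norm_modulation, one_mul])

theorem integrable_rightShift (u : HalfLineL2 H) (η : Measure ℝ) [IsFiniteMeasure η] :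
    Integrable (fun s => rightShift s u) (η.restrict (Set.Ici 0)) := by
  refine Integrable.of_bound ((continuousOn_rightShift u).aestronglyMeasurable measurableSet_Ici)
    ‖u‖ ?_
  filter_upwards [ae_restrict_mem measurableSet_Ici] with s hs
  exact (norm_rightShift hs u).le

/-- The Fourier transform of an average of shifts. -/
theorem fourierIsometry_integral_rightShift (u : HalfLineL2 H) (η : Measure ℝ)
    [IsFiniteMeasure η] :
    fourierIsometry (∫ s in Set.Ici 0, rightShift s u ∂η) =ᵐ[volume]
      fun ξ => (∫ s in Set.Ici 0, modulation s ξ ∂η) • fourierIsometry u ξ := by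
  set κ := η.restrict (Set.Ici 0) with hκ
  set g := fourierIsometry u with hg
  set m : ℝ → ℂ := fun ξ => ∫ s, modulation s ξ ∂κ with hm
  have hmeas : StronglyMeasurable m :=
    (continuous_modulation.comp continuous_swap).stronglyMeasurable.integral_prod_right'
      (ν := κ) (f := fun p : ℝ × ℝ => modulation p.2 p.1)
  have hbound : ∀ ξ, ‖m ξ‖ ≤ κ.real Set.univ := fun ξ => by
    have := norm_integral_le_of_norm_le_const (μ := κ) (f := fun s => modulation s ξ) (C := 1)
      (.of_forall fun s => (norm_modulation s ξ).le)
    simpa using this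
  have hmem : MemLp (fun ξ => m ξ • g ξ) 2 volume := by
    refine (Lp.memLp g).of_le_mul (c := κ.real Set.univ)
      (hmeas.aestronglyMeasurable.smul (Lp.memLp g).1) (.of_forall fun ξ => ?_)
    rw [norm_smul]
    gcongr
    exact hbound ξ
  suffices h : fourierIsometry (∫ s, rightShift s u ∂κ) = hmem.toLp _ by
    rw [h]
    exact hmem.coeFn_toLp
  have hint : Integrable (fun s => fourierIsometry (rightShift s u)) κ :=
    (fourierIsometry (H := H)).toContinuousLinearMap.integrable_comp (integrable_rightShift u η)
  have hcomm : fourierIsometry (∫ s, rightShift s u ∂κ) = ∫ s, fourierIsometry (rightShift s u) ∂κ :=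
    ((fourierIsometry (H := H)).toContinuousLinearMap.integral_comp_comm
      (integrable_rightShift u η)).symm
  rw [hcomm]
  -- The Bochner integral is identified weakly: pair with an arbitrary `h ∈ L²` and exchange the
  -- integrals in `s` and `ξ` by Fubini.
  refine ext_inner_left ℂ fun h => ?_
  rw [← integral_inner hint h, L2.inner_def]
  have h1 : ∀ s ∈ Set.Ici (0 : ℝ), inner ℂ h (fourierIsometry (rightShift s u)) =
      ∫ ξ, modulation s ξ * inner ℂ (h ξ) (g ξ) := fun s hs => by
    rw [L2.inner_def]
    refine integral_congr_ae ?_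
    filter_upwards [fourierIsometry_rightShift hs u] with ξ hξ
    rw [hξ, inner_smul_right]
  rw [setIntegral_congr_fun measurableSet_Ici h1, integral_integral_swap]
  · refine integral_congr_ae ?_
    filter_upwards [hmem.coeFn_toLp] with ξ hξ
    rw [hξ, inner_smul_right, integral_mul_const]
  · have hI : Integrable (fun p : ℝ × ℝ => inner ℂ (h p.2) (g p.2)) (κ.prod volume) :=
      (L2.integrable_inner (𝕜 := ℂ) h g).comp_snd κ
    refine Integrable.bdd_mul (c := 1) hI
      continuous_modulation.aestronglyMeasurable (.of_forall fun p => ?_)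
    exact (norm_modulation p.1 p.2).le

/-! ### The subordinated semigroup as a multiplier and its generator -/

/-- The averaged modulation is the Fourier transform of the stable law at frequency `2πξ`. -/
theorem fourierIsometry_stableShift {β t : ℝ} (h0 : 0 < β) (h1 : β < 1) (ht : 0 ≤ t)
    (u : HalfLineL2 H) :
    fourierIsometry (stableShift β t u) =ᵐ[volume]
      fun ξ => Complex.exp (-(t * stableSymbol β (2 * Real.pi * ξ))) • fourierIsometry u ξ := by
  have hη := isOneSidedStable_oneSidedStable h0 h1 ht
  have := hη.isProbabilityMeasure
  filter_upwards [fourierIsometry_integral_rightShift u (oneSidedStable β t)] with ξ hξ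
  refine hξ.trans ?_
  congr 1
  exact hη.fourier (2 * Real.pi * ξ)

theorem fourierIsometry_diffQuot {β t : ℝ} (h0 : 0 < β) (h1 : β < 1) (ht : 0 < t)
    (u : HalfLineL2 H) :
    fourierIsometry (t⁻¹ • (stableShift β t u - u)) =ᵐ[volume]
      fun ξ => ((t : ℂ)⁻¹ * (Complex.exp (-(t * stableSymbol β (2 * Real.pi * ξ))) - 1)) •
        fourierIsometry u ξ := by
  rw [map_smul, map_sub]
  filter_upwards [fourierIsometry_stableShift h0 h1 ht.le u,
    Lp.coeFn_smul t⁻¹ (fourierIsometry (stableShift β t u) - fourierIsometry u),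
    Lp.coeFn_sub (fourierIsometry (stableShift β t u)) (fourierIsometry u)] with ξ h2 h3 h4
  rw [h3, Pi.smul_apply, h4, Pi.sub_apply, h2, mul_smul, sub_smul, one_smul, ← Complex.coe_smul,
    Complex.ofReal_inv]

theorem fourierIsometry_ae_eq_of_tendsto {β : ℝ} (h0 : 0 < β) (h1 : β < 1) {u v : HalfLineL2 H}
    (h : Tendsto (fun t : ℝ => t⁻¹ • (stableShift β t u - u)) (𝓝[>] 0) (𝓝 v)) :
    fourierIsometry v =ᵐ[volume]
      fun ξ => (-stableSymbol β (2 * Real.pi * ξ)) • fourierIsometry u ξ := by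
  -- A sequence of times suffices: `L²` convergence gives an a.e. convergent subsequence, and the
  -- a.e. multiplier identities hold simultaneously for countably many times.
  have hseq : Tendsto (fun n : ℕ => 1 / ((n : ℝ) + 1)) atTop (𝓝[>] 0) :=
    tendsto_nhdsWithin_iff.2 ⟨tendsto_one_div_add_atTop_nhds_zero_nat,
      .of_forall fun n => by simp only [Set.mem_Ioi]; positivity⟩
  have hL := ((fourierIsometry (H := H)).continuous.tendsto v).comp (h.comp hseq)
  obtain ⟨φ, hφ, hlim⟩ := (tendstoInMeasure_of_tendsto_Lp hL).exists_seq_tendsto_ae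
  have hall := ae_all_iff.2 fun n : ℕ =>
    fourierIsometry_diffQuot h0 h1 (t := 1 / ((n : ℝ) + 1)) (by positivity) u
  filter_upwards [hlim, hall] with ξ h2 h3
  refine tendsto_nhds_unique h2 ?_
  have h4 := ((tendsto_diffQuot_exp (stableSymbol β (2 * Real.pi * ξ))).comp
    (hseq.comp hφ.tendsto_atTop)).smul_const (fourierIsometry u ξ)
  exact h4.congr fun n => (h3 (φ n)).symm

theorem exists_tendsto_of_memLp {β : ℝ} (h0 : 0 < β) (h1 : β < 1) {u : HalfLineL2 H}
    (h : MemLp (fun ξ => (-stableSymbol β (2 * Real.pi * ξ)) • fourierIsometry u ξ) 2 volume) :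
    ∃ v, Tendsto (fun t : ℝ => t⁻¹ • (stableShift β t u - u)) (𝓝[>] 0) (𝓝 v) := by
  have hre := stableSymbol_re_nonneg h0 h1
  -- Using `|t|` gives a member of `L²` with the same bound for every real `t`; only `t > 0` matters
  -- in the limit.
  set G : ℝ → ℝ → HilbertComplexification H := fun t ξ => (((|t| : ℝ) : ℂ)⁻¹ *
    (Complex.exp (-((|t| : ℝ) * stableSymbol β (2 * Real.pi * ξ))) - 1)) • fourierIsometry u ξ
    with hGdef
  have hle : ∀ t ξ, ‖G t ξ‖ ≤ ‖(-stableSymbol β (2 * Real.pi * ξ)) • fourierIsometry u ξ‖ := by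
    intro t ξ
    rw [hGdef, norm_smul, norm_smul, norm_neg]
    gcongr
    exact norm_diffQuot_exp_le (hre _) (abs_nonneg t)
  have hG : ∀ t, MemLp (G t) 2 volume := fun t => by
    have := (measurable_stableSymbol β).comp (measurable_const_mul (2 * Real.pi))
    have hm : Measurable fun ξ : ℝ => ((|t| : ℝ) : ℂ)⁻¹ *
        (Complex.exp (-((|t| : ℝ) * stableSymbol β (2 * Real.pi * ξ))) - 1) := by fun_prop
    exact h.of_le (hm.aestronglyMeasurable.smul (Lp.memLp (fourierIsometry u)).1)
      (.of_forall (hle t))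
  have hlim : Tendsto (fun t => (hG t).toLp (G t)) (𝓝[>] 0) (𝓝 (h.toLp _)) := by
    refine tendsto_toLp_two_of_dominated hG h h.norm (.of_forall fun t => .of_forall (hle t))
      (.of_forall fun _ => le_rfl) (.of_forall fun ξ => ?_)
    refine ((tendsto_diffQuot_exp (stableSymbol β (2 * Real.pi * ξ))).smul_const
      (fourierIsometry u ξ)).congr' ?_
    filter_upwards [self_mem_nhdsWithin] with t (ht : 0 < t)
    rw [hGdef]
    simp only [abs_of_pos ht]
  have hlim' : Tendsto (fun t : ℝ => fourierIsometry (t⁻¹ • (stableShift β t u - u))) (𝓝[>] 0)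
      (𝓝 (h.toLp _)) := by
    refine hlim.congr' ?_
    filter_upwards [self_mem_nhdsWithin] with t (ht : 0 < t)
    refine Lp.ext ((hG t).coeFn_toLp.trans ?_)
    filter_upwards [fourierIsometry_diffQuot h0 h1 ht u] with ξ hξ
    rw [hξ, hGdef]
    simp only [abs_of_pos ht]
  -- Closedness of the range ensures that the limit is again the transform of an `H`-valued function
  -- on the half line.
  have hclosed : IsClosed (Set.range (fourierIsometry (H := H))) :=
    (fourierIsometry (H := H)).isometry.isClosedEmbedding.isClosed_range
  obtain ⟨v, hv⟩ := hclosed.mem_of_tendsto hlim' (.of_forall fun t => Set.mem_range_self _)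
  refine ⟨v, ?_⟩
  rw [(fourierIsometry (H := H)).isometry.isUniformInducing.isInducing.tendsto_nhds_iff, hv]
  exact hlim'

end HalfLineL2

/-! ### The domain and the generator in the variable `r = 2πξ` -/

namespace HalfLineL2

variable {H : Type*} [NormedAddCommGroup H] [InnerProductSpace ℝ H] [CompleteSpace H]

theorem memLp_abs_rpow_smul_hat_iff {β : ℝ} (h0 : 0 < β) (u : HalfLineL2 H) :
    MemLp (fun r : ℝ => (|r| ^ β) • hat u r) 2 (volume : Measure ℝ) ↔
      MemLp (fun ξ => (-stableSymbol β (2 * Real.pi * ξ)) • fourierIsometry u ξ) 2 volume := by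
  have hmeas : AEStronglyMeasurable
      (fun ξ => (-stableSymbol β (2 * Real.pi * ξ)) • fourierIsometry u ξ) volume := by
    have := (measurable_stableSymbol β).comp (measurable_const_mul (2 * Real.pi))
    have hm : Measurable fun ξ : ℝ => -stableSymbol β (2 * Real.pi * ξ) := by fun_prop
    exact hm.aestronglyMeasurable.smul (Lp.memLp (fourierIsometry u)).1
  have hpi : (2 * Real.pi) ≠ 0 := by positivity
  set f : ℝ → HilbertComplexification H := fun r => (|r| ^ β) • hat u r with hf
  let e : ℝ ≃ᵐ ℝ := (Homeomorph.mulLeft₀ (2 * Real.pi) hpi).toMeasurableEquiv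
  have hmap : Measure.map e volume = ENNReal.ofReal |(2 * Real.pi)⁻¹| • volume :=
    Real.map_volume_mul_left hpi
  -- The dilation multiplies Lebesgue measure by a finite nonzero constant, which does not affect
  -- membership in `L²`.
  have hsmul : MemLp f 2 volume ↔ MemLp f 2 (ENNReal.ofReal |(2 * Real.pi)⁻¹| • volume) := by
    refine ⟨fun h => h.smul_measure ENNReal.ofReal_ne_top, fun h => ?_⟩
    have h2 := h.smul_measure (c := (ENNReal.ofReal |(2 * Real.pi)⁻¹|)⁻¹)
      (ENNReal.inv_ne_top.2 (by simp))
    rwa [smul_smul, ENNReal.inv_mul_cancel (by simp) ENNReal.ofReal_ne_top,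
      one_smul] at h2
  rw [hsmul, ← hmap, e.memLp_map_measure_iff]
  have hfe : f ∘ e = fun ξ => (|2 * Real.pi * ξ| ^ β) • fourierIsometry u ξ := by
    ext1 ξ
    have : e ξ = 2 * Real.pi * ξ := rfl
    simp only [Function.comp_apply, this, hf, hat_eq]
    rw [mul_div_cancel_left₀ _ hpi]
  rw [hfe]
  have hmeas' : AEStronglyMeasurable
      (fun ξ : ℝ => (|2 * Real.pi * ξ| ^ β) • fourierIsometry u ξ) volume := by
    have hm : Measurable fun ξ : ℝ => |2 * Real.pi * ξ| ^ β := by fun_prop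
    exact hm.aestronglyMeasurable.smul (Lp.memLp (fourierIsometry u)).1
  refine memLp_congr_norm hmeas' hmeas (.of_forall fun ξ => ?_)
  rw [norm_smul, norm_smul, norm_neg, norm_stableSymbol h0, Real.norm_of_nonneg (by positivity)]

theorem mem_generatorDomain_stableShift_iff {β : ℝ} (h0 : 0 < β) (h1 : β < 1) (u : HalfLineL2 H) :
    u ∈ generatorDomain (stableShift (H := H) β) ↔
      MemLp (fun ξ => (-stableSymbol β (2 * Real.pi * ξ)) • fourierIsometry u ξ) 2 volume := by
  refine ⟨fun ⟨v, hv⟩ => ?_, exists_tendsto_of_memLp h0 h1⟩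
  exact (memLp_congr_ae (fourierIsometry_ae_eq_of_tendsto h0 h1 hv)).1 (Lp.memLp _)

theorem hat_generator {β : ℝ} (h0 : 0 < β) (h1 : β < 1)
    (u : generatorDomain (stableShift (H := H) β)) :
    ∀ᵐ r : ℝ, hat (generator (stableShift (H := H) β) u) r =
      (-stableSymbol β r) • hat (u : HalfLineL2 H) r := by
  have hpi : (2 * Real.pi) ≠ 0 := by positivity
  have h := fourierIsometry_ae_eq_of_tendsto h0 h1 (tendsto_generator _ u)
  have hq : Measure.QuasiMeasurePreserving (fun r : ℝ => r / (2 * Real.pi)) volume volume := by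
    refine ⟨by fun_prop, ?_⟩
    simp_rw [div_eq_mul_inv]
    rw [Real.map_volume_mul_right (inv_ne_zero hpi)]
    exact Measure.smul_absolutelyContinuous
  filter_upwards [hq.ae_eq_comp h] with r hr
  simp only [Function.comp_apply, mul_div_cancel₀ r hpi] at hr
  exact hr

/-! ### Continuous representatives for `β > 1/2` -/

/-- Cauchy–Schwarz applied to `‖𝓕u‖ = w⁻¹ · (w ‖𝓕u‖)` with the weight `w = 1 + |2πξ|^β`. -/
theorem integrable_fourierIsometry_of_memLp {β : ℝ} (h1 : β < 1) (hβ : 1 / 2 < β) {u : HalfLineL2 H}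
    (h : MemLp (fun ξ => (-stableSymbol β (2 * Real.pi * ξ)) • fourierIsometry u ξ) 2 volume) :
    Integrable (fourierIsometry u) volume := by
  have h0 : 0 < β := by linarith
  set w : ℝ → ℝ := fun ξ => 1 + |2 * Real.pi * ξ| ^ β with hw
  have hwpos : ∀ ξ, 0 < w ξ := fun ξ => by positivity
  have hwm : Measurable w := by fun_prop
  have hA : MemLp (fun ξ => w ξ * ‖fourierIsometry u ξ‖) 2 volume := by
    refine ((Lp.memLp (fourierIsometry u)).norm.add h.norm).ae_eq (.of_forall fun ξ => ?_)
    simp only [Pi.add_apply, hw, norm_smul, norm_neg, norm_stableSymbol h0]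
    ring
  have hB : MemLp (fun ξ => (w ξ)⁻¹) 2 volume := by
    refine (memLp_two_iff_integrable_sq hwm.inv.aestronglyMeasurable).2 ?_
    -- `(1 + |ξ|)^(-2β)` is integrable on the line because `2β > 1`.
    have hJ := integrable_one_add_norm (μ := (volume : Measure ℝ)) (E := ℝ) (r := 2 * β)
      (by simp; linarith)
    refine hJ.mono' (by fun_prop) (.of_forall fun ξ => ?_)
    -- Subadditivity of `x ↦ x^β` for `β ≤ 1`, together with `2π ≥ 1`.
    have hge : (1 + ‖ξ‖) ^ β ≤ w ξ := by
      refine (Real.rpow_add_le_add_rpow zero_le_one (norm_nonneg ξ) h0.le h1.le).trans ?_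
      rw [Real.one_rpow, Real.norm_eq_abs]
      change 1 + |ξ| ^ β ≤ 1 + |2 * Real.pi * ξ| ^ β
      rw [abs_mul]
      gcongr
      refine le_mul_of_one_le_left (abs_nonneg ξ) ?_
      rw [abs_of_pos (by positivity)]
      linarith [Real.pi_gt_three]
    rw [Real.norm_of_nonneg (by positivity), Real.rpow_neg (by positivity), mul_comm 2 β,
      Real.rpow_mul (by positivity), Real.rpow_two, Pi.inv_apply, inv_pow]
    gcongr
  have := hB.integrable_mul hA
  refine (integrable_norm_iff (Lp.memLp _).1).1 (this.congr (.of_forall fun ξ => ?_))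
  simp only [Pi.mul_apply]
  rw [inv_mul_cancel_left₀ (hwpos ξ).ne']

theorem exists_continuous_of_integrable_fourierIsometry {u : HalfLineL2 H}
    (h : Integrable (fourierIsometry u) volume) :
    ∃ v : ℝ → H, Continuous v ∧ zeroExt u =ᵐ[volume] v := by
  refine ⟨fun x => (𝓕⁻ (fourierIsometry u : ℝ → HilbertComplexification H) x).re, ?_, ?_⟩
  · have hre : Continuous (HilbertComplexification.re (H := H)) :=
      continuous_fst.comp (WithLp.prod_continuous_ofLp 2 H H)
    exact hre.comp (continuous_fourierInv_of_integrable h)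
  · have hinv : 𝓕⁻ (fourierIsometry u) = toComplexL2 u :=
      FourierTransform.fourierInv_fourier_eq (toComplexL2 u)
    have hae := fourierInv_L2_ae_eq h
    rw [hinv] at hae
    filter_upwards [hae, coeFn_toComplexL2 u] with x h2 h3
    rw [← h2, h3]
    rfl

theorem exists_continuousOn_of_mem_generatorDomain {β : ℝ} (h1 : β < 1) (hβ : 1 / 2 < β)
    {u : HalfLineL2 H} (hu : u ∈ generatorDomain (stableShift (H := H) β)) :
    ∃ v : ℝ → H, ContinuousOn v (Set.Ici 0) ∧ v 0 = 0 ∧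
      ∀ᵐ t ∂((volume : Measure ℝ).restrict (Set.Ici 0)), u t = v t := by
  obtain ⟨v, hv, huv⟩ := exists_continuous_of_integrable_fourierIsometry
    (integrable_fourierIsometry_of_memLp h1 hβ
      ((mem_generatorDomain_stableShift_iff (by linarith) h1 u).1 hu))
  refine ⟨v, hv.continuousOn, ?_, ?_⟩
  · have hneg : v =ᵐ[volume.restrict (Set.Iio 0)] fun _ => 0 := by
      filter_upwards [ae_restrict_of_ae huv, ae_restrict_mem measurableSet_Iio] with x hx hx0
      rw [← hx, zeroExt, Set.indicator_of_notMem (by simpa using hx0)]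
    have hon : Set.EqOn v (fun _ => 0) (Set.Iio 0) :=
      Measure.eqOn_open_of_ae_eq hneg isOpen_Iio hv.continuousOn continuousOn_const
    have := hon.closure hv continuous_const
    rw [closure_Iio] at this
    exact this Set.self_mem_Iic
  · filter_upwards [ae_restrict_of_ae huv, ae_restrict_mem measurableSet_Ici] with x hx hx0
    rw [← hx, zeroExt, Set.indicator_of_mem hx0]

end HalfLineL2

/-! ### The main theorem -/

theorem proposition2p4 {H : Type*} [NormedAddCommGroup H] [InnerProductSpace ℝ H]
    [CompleteSpace H] [TopologicalSpace.SeparableSpace H] (β : ℝ) (hβ0 : 0 < β) (hβ1 : β < 1) :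
    generatorDomain (HalfLineL2.stableShift (H := H) β) =
        {u : HalfLineL2 H |
          MemLp (fun r : ℝ => (|r| ^ β) • HalfLineL2.hat u r) 2 (volume : Measure ℝ)} ∧
    (∀ u : generatorDomain (HalfLineL2.stableShift (H := H) β),
        ∀ᵐ r : ℝ, HalfLineL2.hat (generator (HalfLineL2.stableShift (H := H) β) u) r =
          (-(Complex.I * (r : ℂ)) ^ (β : ℂ)) • HalfLineL2.hat (u : HalfLineL2 H) r) ∧
    (1 / 2 < β → ∀ u ∈ generatorDomain (HalfLineL2.stableShift (H := H) β),
        ∃ v : ℝ → H, ContinuousOn v (Set.Ici 0) ∧ v 0 = 0 ∧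
          ∀ᵐ t ∂((volume : Measure ℝ).restrict (Set.Ici 0)), u t = v t) := by
  refine ⟨Set.ext fun u => ?_, fun u => HalfLineL2.hat_generator hβ0 hβ1 u, fun hβ u hu =>
    HalfLineL2.exists_continuousOn_of_mem_generatorDomain hβ1 hβ hu⟩
  rw [HalfLineL2.mem_generatorDomain_stableShift_iff hβ0 hβ1, Set.mem_ofPred_eq,
    HalfLineL2.memLp_abs_rpow_smul_hat_iff hβ0]
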